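/- **Setting.** Fix $d,L\ge 1$ and $\sigma_W>0$. At rounds $s=1,2,\dots$ one observes a covariate $X_s\in\mathbb R^d$, an arm $\hat a_s\in\{1,\dots,L\}$ and a reward $Y_s\in\mathbb R$. Every $X_s$ has the same density $p\in C^1(\mathbb R^d)$, $p>0$. Let $W_s=S(X_s)$, where $S=-\nabla\log p$ is the score, let $\mathcal F_s=\sigma(X_r,\hat a_r,Y_r:1\le r\le s)$ (with $\mathcal F_0$ trivial), and let $p_{s,i}(W_s)=\mathbb P(\hat a_s=i\mid\mathcal F_{s-1},W_s)$. Let $p_s^\star$ be the (deterministic) essential infimum of the propensities $p_{s,i}(W_s)$ over all arms $i$, contexts and histories, and put $$r_t=\frac1{t^2}\sum_{s=1}^t\frac1{p_s^\star},\qquad \hat\Gamma_{i,t}=\frac1t\sum_{s=1}^t\frac{\mathbf 1\{\hat a_s=i\}}{p_{s,i}(W_s)}W_sW_s^\top .$$ Assume, with a deterministic matrix $\Gamma\in\mathbb R^{d\times d}$: * (A1) $\mathbb E[W_sW_s^\top\mid\mathcal F_{s-1}]=\Gamma$ for every $s\ge1$; * (A2) $r_t$ is finite for all $t$ (that is, every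 $p_s^\star>0$) and $r_t\to0$; * (A3) $\mathbb E\exp(\lambda v^\top W_s)\le\exp(\lambda^2\sigma_W^2/2)$ for all $s\ge 1$, all unit vectors $v$ and all $\lambda\in\mathbb R$; * (A4) $\Gamma$ is positive definite with $\lambda_{\min}(\Gamma)\ge\mu>0$ for some $\mu$. Write $M_k=\sup_{s\ge1}\mathbb E\|W_s\|^k$ and $m_2=\mathbb E\|W_s\|^2$ (the same for all $s$); $\|\cdot\|$ is the Euclidean norm of a vector and the operator norm of a matrix. There are constants $c_1,C_1>0$, depending only on $\sigma_W$ and $d$, with the tail bound $\mathbb P(\|W_s\|>u)\le C_1e^{-c_1u^2}$ for all $s\ge1$, $u\ge0$. Let $c_1,C_1>0$ be any constants with this tail bound. **Theorem (high-probability bound for the IPW Gram matrix).** Let $\delta,\eta\in(0,1/2)$, $M=\sqrt{M_8C_1}$ and, for $t\ge1$, $$\Xi_t=2\log M+\log(1+t\,r_t)+3\log\frac1\eta .$$ Then for every arm $i$ and every $t\ge1$, with probability at least $1-2\delta-\eta$, $$\|\hat\Gamma_{i,t}-\Gamma\|\le 2\sqrt{M_4\,r_t\log\tfrac{2d}\delta}+2\sqrt{\tfrac{m_2^2}{t}\log\tfrac{2d}\delta}+\sqrt{\tfrac{M_4}\delta}\,\sqrt{r_t}+\frac{8}{3c_1}\,\frac{\log(2d/\delta)}{t}\,\max\{\Xi_t,0\}+\eta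 .$$ **Corollary.** If $\alpha\in(0,1/2)$ and $t^{2\alpha}r_t\to0$ as $t\to\infty$, then for every arm $i$, $t^\alpha\|\hat\Gamma_{i,t}-\Gamma\|\to0$ in probability. -/

import Mathlib

open MeasureTheory ProbabilityTheory Filter Topology
open scoped NNReal ENNReal Matrix Gradient

noncomputable section

namespace KSIB

/-- The observed data of a contextual bandit with `L` arms and `d`-dimensional covariates:
covariates `X s`, pulled arms `arm s` and rewards `Y s` at the rounds `s = 1, 2, …`
(index `0` is never used). The arm-selection rule and the reward mechanism are arbitrary. -/
structure Bandit (Ω : Type*) [MeasurableSpace Ω] (d L : ℕ) where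
  X : ℕ → Ω → EuclideanSpace ℝ (Fin d)
  arm : ℕ → Ω → Fin L
  Y : ℕ → Ω → ℝ
  measurable_X : ∀ s, Measurable (X s)
  measurable_arm : ∀ s, Measurable (arm s)
  measurable_Y : ∀ s, Measurable (Y s)

/-- The score function `S(x) = -∇ log p(x)` of a density `p`. -/
def score {d : ℕ} (p : EuclideanSpace ℝ (Fin d) → ℝ) (x : EuclideanSpace ℝ (Fin d)) :
    EuclideanSpace ℝ (Fin d) :=
  -gradient (fun y => Real.log (p y)) x

namespace Bandit

variable {Ω : Type*} [MeasurableSpace Ω] {d L : ℕ}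

/-- Every covariate has the continuously differentiable, everywhere positive density `p`. -/
structure HasDensity (B : Bandit Ω d L) (μ : Measure Ω)
    (p : EuclideanSpace ℝ (Fin d) → ℝ) : Prop where
  contDiff : ContDiff ℝ 1 p
  pos : ∀ x, 0 < p x
  law : ∀ s, 1 ≤ s → μ.map (B.X s) = volume.withDensity (fun x => ENNReal.ofReal (p x))

/-- The score feature `W_s = S(X_s)`. -/
def W (B : Bandit Ω d L) (p : EuclideanSpace ℝ (Fin d) → ℝ) (s : ℕ) (ω : Ω) :
    EuclideanSpace ℝ (Fin d) :=
  score p (B.X s ω)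

/-- The history `𝓕_n = σ(X_r, a_r, Y_r : 1 ≤ r ≤ n)`. -/
abbrev history (B : Bandit Ω d L) (n : ℕ) : MeasurableSpace Ω :=
  ⨆ r ∈ Finset.Icc 1 n,
    (MeasurableSpace.comap (B.X r) inferInstance ⊔ MeasurableSpace.comap (B.arm r) inferInstance ⊔
      MeasurableSpace.comap (B.Y r) inferInstance)

/-- The indicator `1{a_s = i}`. -/
def pulled (B : Bandit Ω d L) (i : Fin L) (s : ℕ) (ω : Ω) : ℝ :=
  if B.arm s ω = i then 1 else 0

/-- The propensity `p_{s,i}(W_s) = P(a_s = i | 𝓕_{s-1}, W_s)`. -/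
def propensity (B : Bandit Ω d L) (μ : Measure Ω) (p : EuclideanSpace ℝ (Fin d) → ℝ)
    (i : Fin L) (s : ℕ) : Ω → ℝ :=
  μ[B.pulled i s | B.history (s - 1) ⊔ MeasurableSpace.comap (B.W p s) inferInstance]

/-- The minimal propensity `p_s^⋆`: the deterministic number which is the smallest value, over all
arms, contexts and histories (up to null sets), of the propensity at round `s`. -/
def minPropensity (B : Bandit Ω d L) (μ : Measure Ω) (p : EuclideanSpace ℝ (Fin d) → ℝ)
    (s : ℕ) : ℝ :=
  ⨅ i : Fin L, essInf (B.propensity μ p i s) μ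

/-- The variance inflation `r_t = t⁻² ∑_{s=1}^t 1 / p_s^⋆`. -/
def rate (B : Bandit Ω d L) (μ : Measure Ω) (p : EuclideanSpace ℝ (Fin d) → ℝ) (t : ℕ) : ℝ :=
  (1 / (t : ℝ) ^ 2) * ∑ s ∈ Finset.Icc 1 t, 1 / B.minPropensity μ p s

/-- The inverse-propensity-weighted Gram matrix
`Γ̂_{i,t} = t⁻¹ ∑_{s=1}^t 1{a_s = i} / p_{s,i}(W_s) • W_s W_sᵀ`. -/
def gramHat (B : Bandit Ω d L) (μ : Measure Ω) (p : EuclideanSpace ℝ (Fin d) → ℝ)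
    (i : Fin L) (t : ℕ) (ω : Ω) : Matrix (Fin d) (Fin d) ℝ :=
  (1 / (t : ℝ)) • ∑ s ∈ Finset.Icc 1 t,
    (B.pulled i s ω / B.propensity μ p i s ω) •
      Matrix.vecMulVec (B.W p s ω).ofLp (B.W p s ω).ofLp

/-- The estimation error `‖Γ̂_{i,t} - Γ‖` in the (Euclidean) operator norm. -/
def gramError (B : Bandit Ω d L) (μ : Measure Ω) (p : EuclideanSpace ℝ (Fin d) → ℝ)
    (Γ : Matrix (Fin d) (Fin d) ℝ) (i : Fin L) (t : ℕ) (ω : Ω) : ℝ :=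
  ‖Matrix.toEuclideanCLM (n := Fin d) (𝕜 := ℝ) (B.gramHat μ p i t ω - Γ)‖

/-- The moment `M_k = sup_{s ≥ 1} E ‖W_s‖^k`. -/
def moment (B : Bandit Ω d L) (μ : Measure Ω) (p : EuclideanSpace ℝ (Fin d) → ℝ) (k : ℕ) : ℝ :=
  ⨆ s : ℕ, ∫ ω, ‖B.W p (s + 1) ω‖ ^ k ∂μ

/-- The second moment `m₂ = E ‖W_s‖²`, which is the same for every `s ≥ 1` when all covariates
have the same law. -/
def secondMoment (B : Bandit Ω d L) (μ : Measure Ω) (p : EuclideanSpace ℝ (Fin d) → ℝ) : ℝ :=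
  ∫ ω, ‖B.W p 1 ω‖ ^ 2 ∂μ

/-- (A1) `E[W_s W_sᵀ | 𝓕_{s-1}] = Γ` almost surely, for every round `s`. -/
def StationarySecondMoment (B : Bandit Ω d L) (μ : Measure Ω)
    (p : EuclideanSpace ℝ (Fin d) → ℝ) (Γ : Matrix (Fin d) (Fin d) ℝ) : Prop :=
  ∀ s, 1 ≤ s → ∀ j k : Fin d,
    μ[fun ω => B.W p s ω j * B.W p s ω k | B.history (s - 1)] =ᵐ[μ] fun _ => Γ j k

/-- (A2) `r_t → 0`. That `r_t` is finite means that every `p_s^⋆` is positive. -/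
def AverageExploration (B : Bandit Ω d L) (μ : Measure Ω)
    (p : EuclideanSpace ℝ (Fin d) → ℝ) : Prop :=
  (∀ s, 1 ≤ s → 0 < B.minPropensity μ p s) ∧ Tendsto (B.rate μ p) atTop (𝓝 0)

/-- (A3) `E exp(l vᵀ W_s) ≤ exp(l² σ² / 2)` for all real `l`, all unit vectors `v` and all `s`. -/
def SubGaussianFeatures (B : Bandit Ω d L) (μ : Measure Ω)
    (p : EuclideanSpace ℝ (Fin d) → ℝ) (σ : ℝ≥0) : Prop :=
  ∀ s, 1 ≤ s → ∀ v : EuclideanSpace ℝ (Fin d), ‖v‖ = 1 →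
    HasSubgaussianMGF (fun ω => inner ℝ v (B.W p s ω)) (σ ^ 2) μ

/-- The tail bound `P(‖W_s‖ > u) ≤ C₁ exp(-c₁ u²)` for all `s ≥ 1` and `u ≥ 0`. -/
def TailBound (B : Bandit Ω d L) (μ : Measure Ω) (p : EuclideanSpace ℝ (Fin d) → ℝ)
    (c₁ C₁ : ℝ) : Prop :=
  ∀ s, 1 ≤ s → ∀ u : ℝ, 0 ≤ u → μ.real {ω | u < ‖B.W p s ω‖} ≤ C₁ * Real.exp (-c₁ * u ^ 2)

/-- `Ξ_t = 2 log M + log(1 + t r_t) + 3 log(1/η)` with `M = √(M₈ C₁)`. -/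
def Xi (B : Bandit Ω d L) (μ : Measure Ω) (p : EuclideanSpace ℝ (Fin d) → ℝ)
    (C₁ η : ℝ) (t : ℕ) : ℝ :=
  2 * Real.log (√(B.moment μ p 8 * C₁)) + Real.log (1 + t * B.rate μ p t)
    + 3 * Real.log (1 / η)

end Bandit

/-- (A4) `Γ` is positive definite with `λ_min(Γ) ≥ m > 0`. -/
def Identifiable {d : ℕ} (Γ : Matrix (Fin d) (Fin d) ℝ) : Prop :=
  ∃ hΓ : Γ.PosDef, ∃ m : ℝ, 0 < m ∧ ∀ j, m ≤ hΓ.isHermitian.eigenvalues j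

end KSIB

end

/-! The third term `√(M₄/δ) √r_t` of the bound is already the Chebyshev radius at level `δ`, so a
variance computation suffices and no exponential inequality or truncation is needed. Every other
term is nonnegative, and `η > 0` makes the inequality strict.

The variance comes from a martingale. Conditioning on `𝓕_{s-1}` and `W_s`, the weight `1{a_s = i} /
p_{s,i}` has mean one, so by the tower property and (A1) each entry of the round-`s` summand minus
`Γ` is a martingale difference. Squaring the weight costs one factor `1 / p_s^⋆`, orthogonality adds
up the variances over rounds, and summing over entries turns `∑ (W_j W_k)²` into `‖W‖⁴`. Hence the
mean squared Frobenius error is at most `M₄ r_t`, and the Frobenius norm dominates the operator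
norm. The corollary is the same Chebyshev bound at level `ε / t^α`. -/

namespace KSIB

/-! ### General tools: orthogonality, matrix norms, weighting, the score. -/

/-- Orthogonality of square-integrable martingale differences. -/
theorem integral_sq_sum_martingaleDiff {Ω : Type*} {m0 : MeasurableSpace Ω} {μ : Measure Ω}
    [IsProbabilityMeasure μ] {𝓕 : ℕ → MeasurableSpace Ω} (hmono : Monotone 𝓕)
    (hle : ∀ n, 𝓕 n ≤ m0) {f : ℕ → Ω → ℝ}
    (hmeas : ∀ s, 1 ≤ s → StronglyMeasurable[𝓕 s] (f s)) (hL2 : ∀ s, 1 ≤ s → MemLp (f s) 2 μ)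
    (hdiff : ∀ s, 1 ≤ s → μ[f s | 𝓕 (s - 1)] =ᵐ[μ] 0) (t : ℕ) :
    ∫ ω, (∑ s ∈ Finset.Icc 1 t, f s ω) ^ 2 ∂μ = ∑ s ∈ Finset.Icc 1 t, ∫ ω, f s ω ^ 2 ∂μ := by
  induction t with
  | zero => simp
  | succ t ih =>
    have hS : MemLp (fun ω => ∑ s ∈ Finset.Icc 1 t, f s ω) 2 μ :=
      memLp_finsetSum _ fun s hs => hL2 s (Finset.mem_Icc.1 hs).1
    have hSm : StronglyMeasurable[𝓕 t] (fun ω => ∑ s ∈ Finset.Icc 1 t, f s ω) :=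
      Finset.stronglyMeasurable_fun_sum _ fun s hs =>
        (hmeas s (Finset.mem_Icc.1 hs).1).mono (hmono (Finset.mem_Icc.1 hs).2)
    have hf := hL2 (t + 1) (by omega)
    have hprod : Integrable ((fun ω => ∑ s ∈ Finset.Icc 1 t, f s ω) * f (t + 1)) μ :=
      hS.integrable_mul hf
    -- The past sum is `𝓕 t`-measurable, so it factors out of the conditional expectation of the
    -- next difference, which is zero.
    have hcross : ∫ ω, (∑ s ∈ Finset.Icc 1 t, f s ω) * f (t + 1) ω ∂μ = 0 := by
      have h1 := condExp_mul_of_stronglyMeasurable_left hSm hprod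
        (hf.integrable one_le_two)
      have h2 : μ[(fun ω => ∑ s ∈ Finset.Icc 1 t, f s ω) * f (t + 1) | 𝓕 t] =ᵐ[μ] 0 := by
        filter_upwards [h1, hdiff (t + 1) (by omega)] with ω h1 h2
        rw [h1, Pi.mul_apply]
        simp only [Nat.add_sub_cancel] at h2
        simp [h2]
      have h3 := integral_condExp (μ := μ)
        (f := (fun ω => ∑ s ∈ Finset.Icc 1 t, f s ω) * f (t + 1)) (hle t)
      rw [integral_congr_ae h2] at h3
      simpa using h3.symm
    have hexp : ∀ ω, (∑ s ∈ Finset.Icc 1 (t + 1), f s ω) ^ 2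
        = (∑ s ∈ Finset.Icc 1 t, f s ω) ^ 2
          + (2 * ((∑ s ∈ Finset.Icc 1 t, f s ω) * f (t + 1) ω) + f (t + 1) ω ^ 2) := by
      intro ω
      rw [Finset.sum_Icc_succ_top (by omega)]
      ring
    simp_rw [hexp]
    have hprod' : Integrable (fun ω => (∑ s ∈ Finset.Icc 1 t, f s ω) * f (t + 1) ω) μ := hprod
    have hrest : Integrable (fun ω => 2 * ((∑ s ∈ Finset.Icc 1 t, f s ω) * f (t + 1) ω)
        + f (t + 1) ω ^ 2) μ := (hprod'.const_mul 2).add hf.integrable_sq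
    rw [integral_add hS.integrable_sq hrest,
      integral_add (hprod'.const_mul 2) hf.integrable_sq, integral_const_mul, hcross, ih,
      Finset.sum_Icc_succ_top (by omega)]
    ring

/-- The operator norm is at most the Frobenius norm. -/
theorem norm_toEuclideanCLM_sq_le {n : Type*} [Fintype n] [DecidableEq n] (A : Matrix n n ℝ) :
    ‖Matrix.toEuclideanCLM (n := n) (𝕜 := ℝ) A‖ ^ 2 ≤ ∑ j, ∑ k, A j k ^ 2 := by
  have h0 : 0 ≤ ∑ j, ∑ k, A j k ^ 2 :=
    Finset.sum_nonneg fun _ _ => Finset.sum_nonneg fun _ _ => sq_nonneg _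
  refine (Real.le_sqrt (norm_nonneg _) h0).1
    (ContinuousLinearMap.opNorm_le_bound _ (Real.sqrt_nonneg _) fun x => ?_)
  refine (sq_le_sq₀ (norm_nonneg _) (by positivity)).1 ?_
  rw [mul_pow, Real.sq_sqrt h0, EuclideanSpace.real_norm_sq_eq, EuclideanSpace.real_norm_sq_eq,
    Finset.sum_mul]
  refine Finset.sum_le_sum fun j _ => ?_
  rw [Matrix.ofLp_toEuclideanCLM]
  -- Cauchy–Schwarz in each row.
  exact Finset.sum_mul_sq_le_sq_mul_sq _ _ _

theorem sum_sum_mul_sq_eq_norm_pow_four {d : ℕ} (w : EuclideanSpace ℝ (Fin d)) :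
    ∑ j, ∑ k, (w j * w k) ^ 2 = ‖w‖ ^ 4 := by
  rw [show ‖w‖ ^ 4 = ‖w‖ ^ 2 * ‖w‖ ^ 2 by ring, EuclideanSpace.real_norm_sq_eq, Finset.sum_mul_sum]
  simp_rw [mul_pow]

/-- Inverse-propensity weighting: if `q = E[a | m]` is bounded below by `c > 0` and `g` is
`m`-measurable, then `E[(a / q) g | m] = g`. -/
theorem condExp_ipw {Ω : Type*} {m m0 : MeasurableSpace Ω} {μ : Measure Ω}
    {a g : Ω → ℝ} (ha : Integrable a μ) (hpos : ∀ᵐ ω ∂μ, 0 < (μ[a | m]) ω)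
    (hg : StronglyMeasurable[m] g) (hint : Integrable (fun ω => a ω / (μ[a | m]) ω * g ω) μ) :
    μ[fun ω => a ω / (μ[a | m]) ω * g ω | m] =ᵐ[μ] g := by
  have hq : StronglyMeasurable[m] (fun ω => g ω / (μ[a | m]) ω) :=
    hg.div stronglyMeasurable_condExp
  have heq : (fun ω => a ω / (μ[a | m]) ω * g ω) = a * fun ω => g ω / (μ[a | m]) ω := by
    ext ω
    simp only [Pi.mul_apply]
    ring
  rw [heq] at hint ⊢
  filter_upwards [condExp_mul_of_stronglyMeasurable_right hq hint ha, hpos] with ω h1 h2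
  rw [h1, Pi.mul_apply, mul_div_cancel₀ _ h2.ne']

theorem continuous_score {d : ℕ} {p : EuclideanSpace ℝ (Fin d) → ℝ} (hp : ContDiff ℝ 1 p)
    (hpos : ∀ x, 0 < p x) : Continuous (score p) := by
  have h : ContDiff ℝ 1 (fun y => Real.log (p y)) := hp.log fun x => (hpos x).ne'
  have h' := h.continuous_fderiv one_ne_zero
  unfold score gradient
  exact ((InnerProductSpace.toDual ℝ _).symm.continuous.comp h').neg

namespace Bandit

/-! ### Filtration, measurability and the propensity lower bound. -/

section Measurability

variable {Ω : Type*} [MeasurableSpace Ω] {d L : ℕ} {μ : Measure Ω} {B : Bandit Ω d L}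
  {p : EuclideanSpace ℝ (Fin d) → ℝ}

theorem history_mono (B : Bandit Ω d L) : Monotone B.history := fun m n hmn =>
  biSup_mono fun r hr => by
    simp only [Finset.mem_Icc] at hr ⊢
    omega

theorem history_le (B : Bandit Ω d L) (n : ℕ) : B.history n ≤ ‹MeasurableSpace Ω› :=
  iSup₂_le fun r _ => sup_le (sup_le (B.measurable_X r).comap_le (B.measurable_arm r).comap_le)
    (B.measurable_Y r).comap_le

theorem comap_X_le_history (B : Bandit Ω d L) {s : ℕ} (hs : 1 ≤ s) :
    MeasurableSpace.comap (B.X s) inferInstance ≤ B.history s :=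
  (le_sup_left.trans le_sup_left).trans
    (le_iSup₂_of_le (f := fun r (_ : r ∈ Finset.Icc 1 s) =>
      MeasurableSpace.comap (B.X r) inferInstance ⊔ MeasurableSpace.comap (B.arm r) inferInstance ⊔
      MeasurableSpace.comap (B.Y r) inferInstance) s (Finset.mem_Icc.2 ⟨hs, le_rfl⟩) le_rfl)

theorem comap_arm_le_history (B : Bandit Ω d L) {s : ℕ} (hs : 1 ≤ s) :
    MeasurableSpace.comap (B.arm s) inferInstance ≤ B.history s :=
  (le_sup_right.trans le_sup_left).trans
    (le_iSup₂_of_le (f := fun r (_ : r ∈ Finset.Icc 1 s) =>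
      MeasurableSpace.comap (B.X r) inferInstance ⊔ MeasurableSpace.comap (B.arm r) inferInstance ⊔
      MeasurableSpace.comap (B.Y r) inferInstance) s (Finset.mem_Icc.2 ⟨hs, le_rfl⟩) le_rfl)

theorem HasDensity.measurable_score (h : B.HasDensity μ p) : Measurable (score p) :=
  (continuous_score h.contDiff h.pos).measurable

theorem HasDensity.measurable_W (h : B.HasDensity μ p) (s : ℕ) : Measurable (B.W p s) :=
  h.measurable_score.comp (B.measurable_X s)

theorem HasDensity.comap_W_le_history (h : B.HasDensity μ p) {s : ℕ} (hs : 1 ≤ s) :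
    MeasurableSpace.comap (B.W p s) inferInstance ≤ B.history s := by
  refine le_trans ?_ (B.comap_X_le_history hs)
  exact (h.measurable_score.comp (comap_measurable (B.X s))).comap_le

/-- The information `𝓕_{s-1} ∨ σ(W_s)` that the propensity is conditioned on. -/
noncomputable abbrev context (B : Bandit Ω d L) (p : EuclideanSpace ℝ (Fin d) → ℝ) (s : ℕ) :
    MeasurableSpace Ω :=
  B.history (s - 1) ⊔ MeasurableSpace.comap (B.W p s) inferInstance

theorem HasDensity.context_le (h : B.HasDensity μ p) (s : ℕ) :
    B.context p s ≤ ‹MeasurableSpace Ω› :=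
  sup_le (B.history_le _) (h.measurable_W s).comap_le

theorem HasDensity.context_le_history (h : B.HasDensity μ p) {s : ℕ} (hs : 1 ≤ s) :
    B.context p s ≤ B.history s :=
  sup_le (B.history_mono (Nat.sub_le s 1)) (h.comap_W_le_history hs)

theorem measurable_pulled_of_comap (B : Bandit Ω d L) (i : Fin L) (s : ℕ) :
    Measurable[MeasurableSpace.comap (B.arm s) inferInstance] (B.pulled i s) :=
  (measurable_from_top (f := fun a : Fin L => if a = i then (1 : ℝ) else 0)).comp
    (comap_measurable (B.arm s))

theorem measurable_pulled (B : Bandit Ω d L) (i : Fin L) (s : ℕ) : Measurable (B.pulled i s) :=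
  (B.measurable_pulled_of_comap i s).mono (B.measurable_arm s).comap_le le_rfl

theorem pulled_nonneg (B : Bandit Ω d L) (i : Fin L) (s : ℕ) (ω : Ω) : 0 ≤ B.pulled i s ω := by
  unfold pulled
  split_ifs <;> norm_num

theorem pulled_le_one (B : Bandit Ω d L) (i : Fin L) (s : ℕ) (ω : Ω) : B.pulled i s ω ≤ 1 := by
  unfold pulled
  split_ifs <;> norm_num

theorem pulled_sq (B : Bandit Ω d L) (i : Fin L) (s : ℕ) (ω : Ω) :
    B.pulled i s ω ^ 2 = B.pulled i s ω := by
  unfold pulled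
  split_ifs <;> norm_num

theorem integrable_pulled [IsFiniteMeasure μ] (B : Bandit Ω d L) (i : Fin L) (s : ℕ) :
    Integrable (B.pulled i s) μ :=
  Integrable.of_bound (B.measurable_pulled i s).aestronglyMeasurable 1
    (ae_of_all _ fun ω => by
      rw [Real.norm_of_nonneg (B.pulled_nonneg i s ω)]
      exact B.pulled_le_one i s ω)

theorem ae_minPropensity_le (B : Bandit Ω d L) (i : Fin L) (s : ℕ) :
    ∀ᵐ ω ∂μ, B.minPropensity μ p s ≤ B.propensity μ p i s ω := by
  -- The reals are only conditionally complete: `essInf` is an a.e. lower bound once the function is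
  -- known to be bounded below.
  have h0 : 0 ≤ᵐ[μ] B.propensity μ p i s :=
    condExp_nonneg (ae_of_all _ (B.pulled_nonneg i s))
  have h1 : ∀ᵐ ω ∂μ, essInf (B.propensity μ p i s) μ ≤ B.propensity μ p i s ω :=
    ae_essInf_le (isBoundedUnder_of_eventually_ge h0)
  filter_upwards [h1] with ω h
  exact (ciInf_le (Set.finite_range _).bddBelow i).trans h

theorem rate_nonneg (h : B.AverageExploration μ p) (t : ℕ) : 0 ≤ B.rate μ p t :=
  mul_nonneg (by positivity) (Finset.sum_nonneg fun s hs =>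
    (one_div_pos.2 (h.1 s (Finset.mem_Icc.1 hs).1)).le)

end Measurability

/-! ### Moments and tails of the score features. -/

section Moments

variable {Ω : Type*} [MeasurableSpace Ω] {d L : ℕ} {μ : Measure Ω}
  {B : Bandit Ω d L} {p : EuclideanSpace ℝ (Fin d) → ℝ} {σ : ℝ≥0}

theorem SubGaussianFeatures.coord (h : B.SubGaussianFeatures μ p σ) {s : ℕ} (hs : 1 ≤ s)
    (j : Fin d) : HasSubgaussianMGF (fun ω => B.W p s ω j) (σ ^ 2) μ := by
  simpa [EuclideanSpace.inner_single_left] using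
    h s hs (EuclideanSpace.single j (1 : ℝ)) (by simp)

theorem SubGaussianFeatures.memLp_mul [IsProbabilityMeasure μ]
    (h : B.SubGaussianFeatures μ p σ) {s : ℕ} (hs : 1 ≤ s)
    (j k : Fin d) : MemLp (fun ω => B.W p s ω j * B.W p s ω k) 2 μ := by
  have : ENNReal.HolderTriple ((4 : ℝ≥0) : ℝ≥0∞) ((4 : ℝ≥0) : ℝ≥0∞) 2 := ⟨by
    rw [← two_mul, show ((4 : ℝ≥0) : ℝ≥0∞) = 2 * 2 by norm_num,
      ENNReal.mul_inv (by simp) (by simp), ← mul_assoc,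
      ENNReal.mul_inv_cancel (by simp) (by simp), one_mul]⟩
  exact MemLp.mul' ((h.coord hs k).memLp 4) ((h.coord hs j).memLp 4)

/-- All `X_s` share one law, so the supremum defining `M_k` runs over a constant family; no
boundedness argument is needed. -/
theorem HasDensity.integral_norm_pow (h : B.HasDensity μ p) {s : ℕ} (hs : 1 ≤ s) (k : ℕ) :
    ∫ ω, ‖B.W p s ω‖ ^ k ∂μ = B.moment μ p k := by
  have key : ∀ r, 1 ≤ r → ∫ ω, ‖B.W p r ω‖ ^ k ∂μ
      = ∫ x, ‖score p x‖ ^ k ∂(volume.withDensity fun x => ENNReal.ofReal (p x)) := fun r hr => by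
    rw [← h.law r hr, integral_map (B.measurable_X r).aemeasurable
      (h.measurable_score.norm.pow_const k).aestronglyMeasurable]
    rfl
  unfold moment
  simp_rw [key _ (Nat.le_add_left 1 _), key s hs, ciSup_const]

/-- If `‖W‖ > u`, some coordinate has absolute value at least `u / √d`; a union bound over the `2d`
one-sided coordinate tails gives the constants. -/
theorem tailBound_of_subGaussian [IsProbabilityMeasure μ]
    (hd : 1 ≤ d) (hσ : 0 < σ) (h : B.SubGaussianFeatures μ p σ) :
    B.TailBound μ p (1 / (2 * d * σ ^ 2)) (2 * d) := by
  intro s hs u hu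
  have hd' : (0 : ℝ) < d := by exact_mod_cast hd
  have hσ' : (0 : ℝ) < σ := by exact_mod_cast hσ
  have hv : 0 ≤ u / √d := by positivity
  have hsub : {ω | u < ‖B.W p s ω‖} ⊆
      ⋃ j : Fin d, ({ω | u / √d ≤ B.W p s ω j} ∪ {ω | u / √d ≤ -B.W p s ω j}) := by
    intro ω hω
    by_contra hcon
    simp only [Set.mem_iUnion, Set.mem_union, Set.mem_ofPred_eq, not_exists, not_or, not_le]
      at hcon hω
    have hle : ‖B.W p s ω‖ ^ 2 ≤ u ^ 2 := by
      rw [EuclideanSpace.real_norm_sq_eq]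
      calc ∑ j, B.W p s ω j ^ 2 ≤ ∑ _j : Fin d, (u / √d) ^ 2 :=
            Finset.sum_le_sum fun j _ => sq_le_sq' (by linarith [(hcon j).2]) (hcon j).1.le
        _ = u ^ 2 := by
            rw [Finset.sum_const, Finset.card_univ, Fintype.card_fin, nsmul_eq_mul, div_pow,
              Real.sq_sqrt hd'.le]
            field_simp
    exact absurd ((sq_le_sq₀ (norm_nonneg _) hu).1 hle) (not_le.2 hω)
  have hexp : -(u / √d) ^ 2 / (2 * ((σ ^ 2 : ℝ≥0) : ℝ)) = -(1 / (2 * d * σ ^ 2)) * u ^ 2 := by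
    rw [div_pow, Real.sq_sqrt hd'.le]
    push_cast
    field_simp
  calc μ.real {ω | u < ‖B.W p s ω‖}
      ≤ μ.real (⋃ j : Fin d, ({ω | u / √d ≤ B.W p s ω j} ∪ {ω | u / √d ≤ -B.W p s ω j})) :=
        measureReal_mono hsub
    _ ≤ ∑ j : Fin d, μ.real ({ω | u / √d ≤ B.W p s ω j} ∪ {ω | u / √d ≤ -B.W p s ω j}) :=
        measureReal_iUnion_fintype_le _
    _ ≤ ∑ _j : Fin d, 2 * Real.exp (-(1 / (2 * d * σ ^ 2)) * u ^ 2) := by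
        refine Finset.sum_le_sum fun j _ => (measureReal_union_le _ _).trans ?_
        have h1 := (h.coord hs j).measure_ge_le hv
        have h2 := (h.coord hs j).neg.measure_ge_le hv
        rw [hexp] at h1 h2
        simp only [Pi.neg_apply] at h2
        linarith
    _ = 2 * d * Real.exp (-(1 / (2 * d * σ ^ 2)) * u ^ 2) := by
        rw [Finset.sum_const, Finset.card_univ, Fintype.card_fin, nsmul_eq_mul]
        ring

end Moments

/-! ### Second moment of the weighted Gram matrix, and Chebyshev. -/

section SecondMoment

variable {Ω : Type*} [MeasurableSpace Ω] {d L : ℕ} {μ : Measure Ω}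
  {B : Bandit Ω d L} {p : EuclideanSpace ℝ (Fin d) → ℝ} {σ : ℝ≥0}
  {Γ : Matrix (Fin d) (Fin d) ℝ}

/-- The `(j, k)` entry of the round-`s` summand of the weighted Gram matrix. -/
noncomputable def ipwEntry (B : Bandit Ω d L) (μ : Measure Ω) (p : EuclideanSpace ℝ (Fin d) → ℝ)
    (i : Fin L) (j k : Fin d) (s : ℕ) (ω : Ω) : ℝ :=
  B.pulled i s ω / B.propensity μ p i s ω * (B.W p s ω j * B.W p s ω k)

theorem stronglyMeasurable_entry_context (B : Bandit Ω d L)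
    (p : EuclideanSpace ℝ (Fin d) → ℝ) (j k : Fin d) (s : ℕ) :
    StronglyMeasurable[B.context p s] (fun ω => B.W p s ω j * B.W p s ω k) := by
  have hW : Measurable[B.context p s] (B.W p s) :=
    (comap_measurable (B.W p s)).mono le_sup_right le_rfl
  have hc : ∀ l : Fin d, Measurable[B.context p s] (fun ω => B.W p s ω l) := fun l =>
    (PiLp.continuous_apply 2 (fun _ : Fin d => ℝ) l).measurable.comp hW
  exact ((hc j).mul (hc k)).stronglyMeasurable

theorem HasDensity.stronglyMeasurable_ipwEntry (h : B.HasDensity μ p) (i : Fin L) (j k : Fin d)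
    {s : ℕ} (hs : 1 ≤ s) : StronglyMeasurable[B.history s] (B.ipwEntry μ p i j k s) := by
  have h1 : StronglyMeasurable[B.history s] (B.pulled i s) :=
    ((B.measurable_pulled_of_comap i s).mono (B.comap_arm_le_history hs) le_rfl).stronglyMeasurable
  have h2 : StronglyMeasurable[B.history s] (B.propensity μ p i s) :=
    (stronglyMeasurable_condExp (m := B.context p s)).mono (h.context_le_history hs)
  have h3 := (B.stronglyMeasurable_entry_context p j k s).mono (h.context_le_history hs)
  exact (h1.div h2).mul h3

/-- The weight is a.s. at most `1 / p_s^⋆`. This crude bound serves integrability only; the variance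
estimate below is sharper. -/
theorem memLp_ipwEntry [IsProbabilityMeasure μ]
    (h : B.HasDensity μ p) (hA : B.AverageExploration μ p)
    (hG : B.SubGaussianFeatures μ p σ) (i : Fin L) (j k : Fin d) {s : ℕ} (hs : 1 ≤ s) :
    MemLp (B.ipwEntry μ p i j k s) 2 μ := by
  have hmeas := ((h.stronglyMeasurable_ipwEntry i j k hs).mono
    (B.history_le s)).aestronglyMeasurable (μ := μ)
  refine MemLp.of_le_mul (c := 1 / B.minPropensity μ p s) (hG.memLp_mul hs j k) hmeas ?_
  have hp := hA.1 s hs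
  filter_upwards [B.ae_minPropensity_le (μ := μ) (p := p) i s] with ω hω
  unfold ipwEntry
  rw [norm_mul]
  refine mul_le_mul_of_nonneg_right ?_ (norm_nonneg _)
  rw [Real.norm_of_nonneg (div_nonneg (B.pulled_nonneg i s ω) (hp.le.trans hω))]
  exact div_le_div₀ zero_le_one (B.pulled_le_one i s ω) hp hω

theorem ae_propensity_pos (hA : B.AverageExploration μ p) (i : Fin L) {s : ℕ} (hs : 1 ≤ s) :
    ∀ᵐ ω ∂μ, 0 < B.propensity μ p i s ω := by
  filter_upwards [B.ae_minPropensity_le (μ := μ) (p := p) i s] with ω hω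
  exact (hA.1 s hs).trans_le hω

theorem condExp_ipwEntry [IsProbabilityMeasure μ]
    (h : B.HasDensity μ p) (hΓ : B.StationarySecondMoment μ p Γ)
    (hA : B.AverageExploration μ p) (hG : B.SubGaussianFeatures μ p σ) (i : Fin L) (j k : Fin d)
    {s : ℕ} (hs : 1 ≤ s) :
    μ[B.ipwEntry μ p i j k s | B.history (s - 1)] =ᵐ[μ] fun _ => Γ j k := by
  have h1 : μ[B.ipwEntry μ p i j k s | B.context p s] =ᵐ[μ]
      fun ω => B.W p s ω j * B.W p s ω k :=
    condExp_ipw (B.integrable_pulled i s) (ae_propensity_pos hA i hs)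
      (B.stronglyMeasurable_entry_context p j k s)
      ((memLp_ipwEntry h hA hG i j k hs).integrable one_le_two)
  have h2 := condExp_condExp_of_le (f := B.ipwEntry μ p i j k s) (μ := μ)
    (le_sup_left : B.history (s - 1) ≤ B.context p s) (h.context_le s)
  exact (h2.symm.trans (condExp_congr_ae h1)).trans (hΓ s hs j k)

/-- An indicator equals its square, so the squared weight is `(a / q) · (1 / q)`. The first factor
averages out given the context, leaving one `1 / q ≤ 1 / p_s^⋆` instead of two. -/
theorem integral_ipwEntry_sq_le [IsProbabilityMeasure μ] (h : B.HasDensity μ p)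
    (hA : B.AverageExploration μ p) (hG : B.SubGaussianFeatures μ p σ) (i : Fin L) (j k : Fin d)
    {s : ℕ} (hs : 1 ≤ s) :
    ∫ ω, B.ipwEntry μ p i j k s ω ^ 2 ∂μ
      ≤ 1 / B.minPropensity μ p s * ∫ ω, (B.W p s ω j * B.W p s ω k) ^ 2 ∂μ := by
  have hp := hA.1 s hs
  set g : Ω → ℝ := fun ω => (B.W p s ω j * B.W p s ω k) ^ 2 / B.propensity μ p i s ω with hgdef
  have hgm : StronglyMeasurable[B.context p s] g :=
    ((B.stronglyMeasurable_entry_context p j k s).pow 2).div stronglyMeasurable_condExp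
  have heq : (fun ω => B.ipwEntry μ p i j k s ω ^ 2)
      = fun ω => B.pulled i s ω / B.propensity μ p i s ω * g ω := by
    ext ω
    simp only [ipwEntry, hgdef, mul_pow, div_pow, B.pulled_sq]
    ring
  have hint : Integrable (fun ω => B.pulled i s ω / B.propensity μ p i s ω * g ω) μ := by
    rw [← heq]
    exact (memLp_ipwEntry h hA hG i j k hs).integrable_sq
  have h1 : μ[fun ω => B.pulled i s ω / B.propensity μ p i s ω * g ω | B.context p s] =ᵐ[μ] g :=
    condExp_ipw (B.integrable_pulled i s) (ae_propensity_pos hA i hs) hgm hint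
  have hgint : Integrable g μ := integrable_condExp.congr h1
  rw [heq, ← integral_condExp (h.context_le s), integral_congr_ae h1, ← integral_const_mul]
  refine integral_mono_ae hgint ((hG.memLp_mul hs j k).integrable_sq.const_mul _) ?_
  filter_upwards [B.ae_minPropensity_le (μ := μ) (p := p) i s] with ω hω
  rw [hgdef, div_mul_eq_mul_div, one_mul]
  exact div_le_div_of_nonneg_left (sq_nonneg _) hp hω

/-- `Γ j k` is the mean of the entry, and a variance is at most the second moment. -/
theorem integral_ipwEntry_sub_sq_le [IsProbabilityMeasure μ]
    (h : B.HasDensity μ p) (hΓ : B.StationarySecondMoment μ p Γ)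
    (hA : B.AverageExploration μ p) (hG : B.SubGaussianFeatures μ p σ) (i : Fin L) (j k : Fin d)
    {s : ℕ} (hs : 1 ≤ s) :
    ∫ ω, (B.ipwEntry μ p i j k s ω - Γ j k) ^ 2 ∂μ
      ≤ 1 / B.minPropensity μ p s * ∫ ω, (B.W p s ω j * B.W p s ω k) ^ 2 ∂μ := by
  refine le_trans ?_ (integral_ipwEntry_sq_le h hA hG i j k hs)
  have hL := memLp_ipwEntry h hA hG i j k hs
  have hI := hL.integrable one_le_two
  have hmean : ∫ ω, B.ipwEntry μ p i j k s ω ∂μ = Γ j k := by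
    rw [← integral_condExp (B.history_le (s - 1)),
      integral_congr_ae (condExp_ipwEntry h hΓ hA hG i j k hs)]
    simp
  have hexp : ∀ ω, (B.ipwEntry μ p i j k s ω - Γ j k) ^ 2
      = B.ipwEntry μ p i j k s ω ^ 2 - (2 * Γ j k * B.ipwEntry μ p i j k s ω - Γ j k ^ 2) :=
    fun ω => by ring
  simp_rw [hexp]
  have hrest : Integrable (fun ω => 2 * Γ j k * B.ipwEntry μ p i j k s ω - Γ j k ^ 2) μ :=
    (hI.const_mul _).sub (integrable_const _)
  rw [integral_sub hL.integrable_sq hrest,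
    integral_sub (hI.const_mul _) (integrable_const _), integral_const_mul, hmean]
  simp only [integral_const, probReal_univ, smul_eq_mul, one_mul]
  nlinarith [sq_nonneg (Γ j k)]

theorem gramHat_sub_apply (B : Bandit Ω d L) (i : Fin L) {t : ℕ} (ht : 1 ≤ t) (j k : Fin d)
    (ω : Ω) : (B.gramHat μ p i t ω - Γ) j k
      = 1 / (t : ℝ) * ∑ s ∈ Finset.Icc 1 t, (B.ipwEntry μ p i j k s ω - Γ j k) := by
  have ht' : (t : ℝ) ≠ 0 := by exact_mod_cast (by omega : t ≠ 0)
  rw [Finset.sum_sub_distrib, Finset.sum_const, Nat.card_Icc, Nat.add_sub_cancel, nsmul_eq_mul,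
    mul_sub, ← mul_assoc (1 / (t : ℝ)) (t : ℝ), one_div_mul_cancel ht', one_mul]
  simp [gramHat, Matrix.sum_apply, Matrix.vecMulVec_apply, ipwEntry]

theorem memLp_gramHat_sub [IsProbabilityMeasure μ]
    (h : B.HasDensity μ p) (hA : B.AverageExploration μ p)
    (hG : B.SubGaussianFeatures μ p σ) (i : Fin L) {t : ℕ} (ht : 1 ≤ t) (j k : Fin d) :
    MemLp (fun ω => (B.gramHat μ p i t ω - Γ) j k) 2 μ := by
  simp_rw [gramHat_sub_apply B i ht]
  exact (memLp_finsetSum _ fun s hs =>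
    (memLp_ipwEntry h hA hG i j k (Finset.mem_Icc.1 hs).1).sub (memLp_const _)).const_mul _

theorem integral_gramHat_sub_sq_le [IsProbabilityMeasure μ]
    (h : B.HasDensity μ p) (hΓ : B.StationarySecondMoment μ p Γ)
    (hA : B.AverageExploration μ p) (hG : B.SubGaussianFeatures μ p σ) (i : Fin L)
    {t : ℕ} (ht : 1 ≤ t) (j k : Fin d) :
    ∫ ω, ((B.gramHat μ p i t ω - Γ) j k) ^ 2 ∂μ
      ≤ 1 / (t : ℝ) ^ 2 * ∑ s ∈ Finset.Icc 1 t,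
        1 / B.minPropensity μ p s * ∫ ω, (B.W p s ω j * B.W p s ω k) ^ 2 ∂μ := by
  simp_rw [gramHat_sub_apply B i ht, mul_pow, one_div_pow]
  rw [integral_const_mul, integral_sq_sum_martingaleDiff
    (f := fun s ω => B.ipwEntry μ p i j k s ω - Γ j k) B.history_mono B.history_le
    (fun s hs => (h.stronglyMeasurable_ipwEntry i j k hs).sub stronglyMeasurable_const)
    (fun s hs => (memLp_ipwEntry h hA hG i j k hs).sub (memLp_const _))]
  · refine mul_le_mul_of_nonneg_left (Finset.sum_le_sum fun s hs => ?_) (by positivity)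
    simpa only [mul_pow] using
      integral_ipwEntry_sub_sq_le h hΓ hA hG i j k (Finset.mem_Icc.1 hs).1
  · intro s hs
    have h1 := condExp_sub (μ := μ) ((memLp_ipwEntry h hA hG i j k hs).integrable one_le_two)
      (integrable_const (Γ j k)) (B.history (s - 1))
    have h2 := condExp_ipwEntry h hΓ hA hG i j k hs
    rw [condExp_const (B.history_le (s - 1))] at h1
    refine EventuallyEq.trans h1 ?_
    filter_upwards [h2] with ω h2
    simp [h2]

/-- The mean squared Frobenius error of the weighted Gram matrix is at most `M₄ r_t`. -/
theorem integral_frobenius_sq_le [IsProbabilityMeasure μ]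
    (h : B.HasDensity μ p) (hΓ : B.StationarySecondMoment μ p Γ)
    (hA : B.AverageExploration μ p) (hG : B.SubGaussianFeatures μ p σ) (i : Fin L)
    {t : ℕ} (ht : 1 ≤ t) :
    ∫ ω, ∑ j, ∑ k, ((B.gramHat μ p i t ω - Γ) j k) ^ 2 ∂μ ≤ B.moment μ p 4 * B.rate μ p t := by
  have hsq : ∀ j k, Integrable (fun ω => ((B.gramHat μ p i t ω - Γ) j k) ^ 2) μ := fun j k =>
    (memLp_gramHat_sub h hA hG i ht j k).integrable_sq
  rw [integral_finsetSum _ fun j _ => integrable_finsetSum _ fun k _ => hsq j k]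
  simp_rw [integral_finsetSum _ fun k _ => hsq _ k]
  calc ∑ j, ∑ k, ∫ ω, ((B.gramHat μ p i t ω - Γ) j k) ^ 2 ∂μ
      ≤ ∑ j, ∑ k, 1 / (t : ℝ) ^ 2 * ∑ s ∈ Finset.Icc 1 t,
        1 / B.minPropensity μ p s * ∫ ω, (B.W p s ω j * B.W p s ω k) ^ 2 ∂μ :=
        Finset.sum_le_sum fun j _ => Finset.sum_le_sum fun k _ =>
          integral_gramHat_sub_sq_le h hΓ hA hG i ht j k
    _ = 1 / (t : ℝ) ^ 2 * ∑ s ∈ Finset.Icc 1 t, 1 / B.minPropensity μ p s *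
          ∑ j, ∑ k, ∫ ω, (B.W p s ω j * B.W p s ω k) ^ 2 ∂μ := by
        simp_rw [← Finset.mul_sum]
        congr 1
        simp_rw [Finset.sum_comm (s := (Finset.univ : Finset (Fin d))) (t := Finset.Icc 1 t),
          ← Finset.mul_sum]
    _ = 1 / (t : ℝ) ^ 2 * ∑ s ∈ Finset.Icc 1 t,
          1 / B.minPropensity μ p s * B.moment μ p 4 := by
        congr 1
        refine Finset.sum_congr rfl fun s hs => ?_
        have hs' := (Finset.mem_Icc.1 hs).1
        congr 1
        rw [← h.integral_norm_pow hs' 4]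
        simp_rw [← sum_sum_mul_sq_eq_norm_pow_four]
        rw [integral_finsetSum _ fun j _ => integrable_finsetSum _ fun k _ =>
          (hG.memLp_mul hs' j k).integrable_sq]
        simp_rw [integral_finsetSum _ fun k _ => (hG.memLp_mul hs' _ k).integrable_sq]
    _ = B.moment μ p 4 * B.rate μ p t := by
        rw [← Finset.sum_mul, rate]
        ring

/-- Chebyshev's inequality for the error of the weighted Gram matrix. -/
theorem sq_mul_measureReal_gramError_ge_le [IsProbabilityMeasure μ] (h : B.HasDensity μ p)
    (hΓ : B.StationarySecondMoment μ p Γ)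
    (hA : B.AverageExploration μ p) (hG : B.SubGaussianFeatures μ p σ) (i : Fin L)
    {t : ℕ} (ht : 1 ≤ t) {ε : ℝ} (hε : 0 ≤ ε) :
    ε ^ 2 * μ.real {ω | ε ≤ B.gramError μ p Γ i t ω} ≤ B.moment μ p 4 * B.rate μ p t := by
  refine le_trans ?_ (integral_frobenius_sq_le h hΓ hA hG i ht)
  refine le_trans ?_ (mul_meas_ge_le_integral_of_nonneg
    (ae_of_all _ fun ω => Finset.sum_nonneg fun j _ => Finset.sum_nonneg fun k _ => sq_nonneg _)
    (integrable_finsetSum _ fun j _ => integrable_finsetSum _ fun k _ =>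
      (memLp_gramHat_sub h hA hG i ht j k).integrable_sq) (ε ^ 2))
  refine mul_le_mul_of_nonneg_left (measureReal_mono fun ω hω => ?_) (sq_nonneg _)
  exact (pow_le_pow_left₀ hε hω 2).trans (norm_toEuclideanCLM_sq_le _)

theorem moment_nonneg (B : Bandit Ω d L) (k : ℕ) : 0 ≤ B.moment μ p k :=
  Real.iSup_nonneg fun _ => integral_nonneg fun _ => by positivity

/-- Chebyshev at level `b`, with `b² δ ≥ M₄ r_t`. Strictness in `hb` forces `b > 0`, so `b²` can be
cancelled even when the radius is zero. -/
theorem one_sub_le_measureReal_gramError_le [IsProbabilityMeasure μ] (h : B.HasDensity μ p)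
    (hΓ : B.StationarySecondMoment μ p Γ)
    (hA : B.AverageExploration μ p) (hG : B.SubGaussianFeatures μ p σ) (i : Fin L)
    {t : ℕ} (ht : 1 ≤ t) {δ b : ℝ} (hδ : 0 < δ)
    (hb : √(B.moment μ p 4 / δ) * √(B.rate μ p t) < b) :
    1 - δ ≤ μ.real {ω | B.gramError μ p Γ i t ω ≤ b} := by
  have hM := B.moment_nonneg (μ := μ) (p := p) 4
  have hr := rate_nonneg hA t
  have hb0 : 0 < b := lt_of_le_of_lt (by positivity) hb
  have hcheb := sq_mul_measureReal_gramError_ge_le h hΓ hA hG i ht hb0.le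
  have hK : B.moment μ p 4 * B.rate μ p t ≤ b ^ 2 * δ := by
    have h1 := pow_le_pow_left₀ (by positivity) hb.le 2
    rw [mul_pow, Real.sq_sqrt (by positivity), Real.sq_sqrt hr, div_mul_eq_mul_div,
      div_le_iff₀ hδ] at h1
    exact h1
  have hbad : μ.real {ω | b ≤ B.gramError μ p Γ i t ω} ≤ δ :=
    le_of_mul_le_mul_left (hcheb.trans hK) (by positivity)
  -- A covering with subadditivity replaces taking complements, so measurability of the events is
  -- not required.
  have hcover : (Set.univ : Set Ω) ⊆
      {ω | B.gramError μ p Γ i t ω ≤ b} ∪ {ω | b ≤ B.gramError μ p Γ i t ω} :=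
    fun ω _ => (le_total (B.gramError μ p Γ i t ω) b).elim (fun h => Or.inl h) fun h => Or.inr h
  have h1 := (measureReal_mono (μ := μ) hcover).trans (measureReal_union_le _ _)
  rw [probReal_univ] at h1
  linarith

theorem tendstoInMeasure_rpow_mul_gramError [IsProbabilityMeasure μ] (h : B.HasDensity μ p)
    (hΓ : B.StationarySecondMoment μ p Γ)
    (hA : B.AverageExploration μ p) (hG : B.SubGaussianFeatures μ p σ) (i : Fin L) {α : ℝ}
    (hα : Tendsto (fun t : ℕ => (t : ℝ) ^ (2 * α) * B.rate μ p t) atTop (𝓝 0)) :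
    TendstoInMeasure μ (fun (t : ℕ) ω => (t : ℝ) ^ α * B.gramError μ p Γ i t ω)
      atTop (fun _ => 0) := by
  rw [tendstoInMeasure_iff_measureReal_norm]
  intro ε hε
  have hlim := hα.const_mul (B.moment μ p 4 / ε ^ 2)
  rw [mul_zero] at hlim
  refine tendsto_of_tendsto_of_tendsto_of_le_of_le' tendsto_const_nhds hlim
    (Eventually.of_forall fun t => measureReal_nonneg) ?_
  filter_upwards [eventually_ge_atTop 1] with t ht
  have ht0 : (0 : ℝ) < t := by exact_mod_cast ht
  have hτ : 0 < (t : ℝ) ^ α := Real.rpow_pos_of_pos ht0 α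
  have hset : {ω | ε ≤ ‖(t : ℝ) ^ α * B.gramError μ p Γ i t ω - 0‖}
      = {ω | ε / (t : ℝ) ^ α ≤ B.gramError μ p Γ i t ω} := by
    ext ω
    have h0 : 0 ≤ B.gramError μ p Γ i t ω := norm_nonneg _
    rw [Set.mem_ofPred_eq, Set.mem_ofPred_eq, sub_zero, Real.norm_of_nonneg (by positivity),
      div_le_iff₀ hτ, mul_comm]
  -- Chebyshev at `ε / t^α` gives probability at most `M₄ t^(2α) r_t / ε²`.
  have hcheb := sq_mul_measureReal_gramError_ge_le h hΓ hA hG i ht (div_pos hε hτ).le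
  have hpow : (t : ℝ) ^ (2 * α) = ((t : ℝ) ^ α) ^ 2 := by
    rw [mul_comm, Real.rpow_mul ht0.le, Real.rpow_two]
  rw [hset, hpow]
  rw [div_pow, div_mul_eq_mul_div, div_le_iff₀ (by positivity)] at hcheb
  rw [div_mul_eq_mul_div, le_div_iff₀ (by positivity)]
  linarith

end SecondMoment

end Bandit

end KSIB

/-! ### Assembly of the theorem. -/

theorem mainTheorem9 (d L : ℕ) (hd : 1 ≤ d) (σ : ℝ≥0) (hσ : 0 < σ) :
    -- constants of the sub-Gaussian tail bound exist that depend only on `σ` and `d`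
    ∃ c C : ℝ, 0 < c ∧ 0 < C ∧
      ∀ (Ω : Type*) [MeasurableSpace Ω] (μ : Measure Ω) [IsProbabilityMeasure μ]
        (B : KSIB.Bandit Ω d L) (p : EuclideanSpace ℝ (Fin d) → ℝ)
        (Γ : Matrix (Fin d) (Fin d) ℝ),
        B.HasDensity μ p →
        B.StationarySecondMoment μ p Γ →
        B.AverageExploration μ p →
        B.SubGaussianFeatures μ p σ →
        KSIB.Identifiable Γ →
        B.TailBound μ p c C ∧
        -- the high-probability bound, for any constants of the tail bound
        (∀ c₁ C₁ : ℝ, 0 < c₁ → 0 < C₁ → B.TailBound μ p c₁ C₁ →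
          ∀ (i : Fin L) (t : ℕ), 1 ≤ t →
          ∀ δ ∈ Set.Ioo (0 : ℝ) (1 / 2), ∀ η ∈ Set.Ioo (0 : ℝ) (1 / 2),
            1 - 2 * δ - η ≤ μ.real {ω | B.gramError μ p Γ i t ω ≤
              2 * √(B.moment μ p 4 * B.rate μ p t * Real.log (2 * d / δ))
              + 2 * √(B.secondMoment μ p ^ 2 / t * Real.log (2 * d / δ))
              + √(B.moment μ p 4 / δ) * √(B.rate μ p t)
              + 8 / (3 * c₁) * (Real.log (2 * d / δ) / t) * max (B.Xi μ p C₁ η t) 0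
              + η}) ∧
        -- the corollary
        (∀ (i : Fin L) (α : ℝ), α ∈ Set.Ioo (0 : ℝ) (1 / 2) →
          Tendsto (fun t : ℕ => (t : ℝ) ^ (2 * α) * B.rate μ p t) atTop (𝓝 0) →
          TendstoInMeasure μ (fun (t : ℕ) ω => (t : ℝ) ^ α * B.gramError μ p Γ i t ω)
            atTop (fun _ => 0)) := by
  have hd' : (1 : ℝ) ≤ d := by exact_mod_cast hd
  have hσ' : (0 : ℝ) < σ := by exact_mod_cast hσ
  refine ⟨1 / (2 * d * σ ^ 2), 2 * d, by positivity, by positivity, ?_⟩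
  intro Ω _ μ _ B p Γ hp hΓ hA hG _
  refine ⟨KSIB.Bandit.tailBound_of_subGaussian hd hσ hG, ?_, fun i α _ hα =>
    KSIB.Bandit.tendstoInMeasure_rpow_mul_gramError hp hΓ hA hG i hα⟩
  intro c₁ C₁ hc₁ _ _ i t ht δ hδ η hη
  -- `2d / δ ≥ 1`, so the term with the factor `Ξ_t` is nonnegative, as are the two square roots.
  have hlog : 0 ≤ Real.log (2 * d / δ) := by
    refine Real.log_nonneg ?_
    rw [le_div_iff₀ hδ.1]
    linarith [hδ.2]
  have h1 : 0 ≤ √(B.moment μ p 4 * B.rate μ p t * Real.log (2 * d / δ)) := Real.sqrt_nonneg _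
  have h2 : 0 ≤ √(B.secondMoment μ p ^ 2 / t * Real.log (2 * d / δ)) := Real.sqrt_nonneg _
  have h3 : 0 ≤ 8 / (3 * c₁) * (Real.log (2 * d / δ) / t) * max (B.Xi μ p C₁ η t) 0 := by
    have := le_max_right (B.Xi μ p C₁ η t) 0
    positivity
  refine le_trans ?_ (KSIB.Bandit.one_sub_le_measureReal_gramError_le hp hΓ hA hG i ht hδ.1 ?_)
  · linarith [hδ.1, hη.1]
  -- The summand `η > 0` supplies the strict inequality.
  · linarith [hη.1]
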